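/- Throughout, rings are associative with unit and modules are left modules. Let $R$ be a left perfect ring, i.e. a ring over which every module has a projective cover (a surjection $P\to M$ with $P$ projective whose kernel $K$ is superfluous: $N+K=P$ implies $N=P$ for submodules $N\subseteq P$). For an $R$-module $M$ let $\Omega_R(M)$ be the kernel of a projective cover of $M$, and put $\Omega_R^0(M):=M$, $\Omega_R^{n}(M):=\Omega_R(\Omega_R^{n-1}(M))$ for $n\ge 1$; these are well defined up to isomorphism. Call $M$ *periodic* if $\Omega_R^p(M)\cong M$ for some $p>0$; the least such $p$ is the *period* of $M$. Call $M$ *eventually periodic* if $\Omega_R^n(M)$ is periodic for some $n\ge 0$, and let $$\operatorname{per.dim}_R M:=\inf\{\,n\ge 0\mid \Omega_R^n(M)\text{ is periodic}\,\}.$$ A module $G$ is *Gorenstein projective* if $G\cong\operatorname{Coker}(T_1\to T_0)$ for some acyclic complex $T_\bullet=(\cdots\to T_1\to T_0\to T_{-1}\to\cdots)$ of projective $R$-modules such that $\operatorname{Hom}_R(T_\bullet,Q)$ is acyclic for every projective $R$-module $Q$. The *Gorenstein projective dimension* $\operatorname{Gpd}_R M$ is the infimum of the integers $n\ge 0$ for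 which there is an exact sequence $0\to G_n\to\cdots\to G_0\to M\to 0$ with all $G_i$ Gorenstein projective. The *stable category* $R\text{-}\underline{\mathrm{Mod}}$ has the $R$-modules as objects and, as morphisms $M\to N$, the group $\operatorname{Hom}_R(M,N)$ modulo the subgroup of maps that factor through a projective module. **Theorem.** Let $R$ be a left perfect ring and let $M$ be an eventually periodic $R$-module of finite Gorenstein projective dimension $r=\operatorname{Gpd}_R M$. Then $$r\ \le\ \operatorname{per.dim}_R M\ \le\ r+1 .$$ Moreover, if $n=\operatorname{per.dim}_R M$ and $p$ is the period of the first periodic syzygy $\Omega_R^n(M)$ of $M$, then there is an isomorphism $$\Omega_R^{r+p}(M)\;\cong\;\Omega_R^{r}(M)\qquad\text{in } R\text{-}\underline{\mathrm{Mod}} .$$ -/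

import Mathlib

universe u

open CategoryTheory

namespace PeriodicDimension

section Syzygies

variable {R : Type u} [Ring R]

/-- A projective cover: a surjection from a projective module whose kernel is superfluous. -/
structure IsProjectiveCover {P M : ModuleCat.{u} R} (f : P →ₗ[R] M) : Prop where
  projective : Module.Projective R P
  surjective : Function.Surjective f
  superfluous : ∀ N : Submodule R P, N ⊔ LinearMap.ker f = ⊤ → N = ⊤

/-- A ring is left perfect if every left module has a projective cover. -/
class IsLeftPerfect (R : Type u) [Ring R] : Prop where
  exists_projectiveCover : ∀ M : ModuleCat.{u} R,
    ∃ (P : ModuleCat.{u} R) (f : P →ₗ[R] M), IsProjectiveCover f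

variable [IsLeftPerfect R]

/-- The source of a chosen projective cover of `M`. -/
noncomputable def coverObj (M : ModuleCat.{u} R) : ModuleCat.{u} R :=
  (IsLeftPerfect.exists_projectiveCover M).choose

/-- A chosen projective cover of `M`. -/
noncomputable def coverMap (M : ModuleCat.{u} R) : coverObj M →ₗ[R] M :=
  (IsLeftPerfect.exists_projectiveCover M).choose_spec.choose

theorem isProjectiveCover_coverMap (M : ModuleCat.{u} R) : IsProjectiveCover (coverMap M) :=
  (IsLeftPerfect.exists_projectiveCover M).choose_spec.choose_spec

/-- The syzygy of `M`: the kernel of a projective cover of `M`. -/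
noncomputable def syzygy (M : ModuleCat.{u} R) : ModuleCat.{u} R :=
  ModuleCat.of R (LinearMap.ker (coverMap M))

/-- The `n`-th syzygy of `M`. -/
noncomputable def nthSyzygy (M : ModuleCat.{u} R) : ℕ → ModuleCat.{u} R
  | 0 => M
  | n + 1 => syzygy (nthSyzygy M n)

/-- `M` is periodic if it is isomorphic to its `p`-th syzygy for some `p > 0`. -/
def IsPeriodic (M : ModuleCat.{u} R) : Prop :=
  ∃ p : ℕ, 0 < p ∧ Nonempty (nthSyzygy M p ≃ₗ[R] M)

/-- The period of a periodic module (only meaningful when `M` is periodic). -/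
noncomputable def period (M : ModuleCat.{u} R) : ℕ :=
  sInf {p : ℕ | 0 < p ∧ Nonempty (nthSyzygy M p ≃ₗ[R] M)}

/-- `M` is eventually periodic if some syzygy of `M` is periodic. -/
def IsEventuallyPeriodic (M : ModuleCat.{u} R) : Prop :=
  ∃ n : ℕ, IsPeriodic (nthSyzygy M n)

/-- The periodic dimension: the infimum of all `n` whose `n`-th syzygy is periodic
(`⊤` if there are none). -/
noncomputable def perDim (M : ModuleCat.{u} R) : ℕ∞ :=
  ⨅ (n : ℕ) (_ : IsPeriodic (nthSyzygy M n)), (n : ℕ∞)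

end Syzygies

section Gorenstein

variable {R : Type u} [Ring R]

/-- A totally acyclic complex: an acyclic complex of projective modules (indexed by `ℤ`) that stays
acyclic after applying `Hom(-, Q)`, for every projective module `Q`. -/
structure IsTotallyAcyclic (T : ChainComplex (ModuleCat.{u} R) ℤ) : Prop where
  projective : ∀ i : ℤ, Module.Projective R (T.X i)
  acyclic : T.Acyclic
  hom_acyclic : ∀ Q : ModuleCat.{u} R, Module.Projective R Q → ∀ i : ℤ,
    Function.Exact (fun g : T.X i ⟶ Q => T.d (i + 1) i ≫ g)
      (fun g : T.X (i + 1) ⟶ Q => T.d (i + 2) (i + 1) ≫ g)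

/-- `M` is Gorenstein projective if it is the cokernel of `T₁ → T₀` for a totally acyclic `T`. -/
def IsGorensteinProjective (M : ModuleCat.{u} R) : Prop :=
  ∃ T : ChainComplex (ModuleCat.{u} R) ℤ, IsTotallyAcyclic T ∧
    Nonempty ((T.X 0 ⧸ LinearMap.range (T.d 1 0).hom) ≃ₗ[R] M)

/-- There is an exact sequence `0 → Gₙ → ⋯ → G₁ → G₀ → M → 0` with every `Gᵢ` Gorenstein
projective (the sequence is continued by zero modules beyond degree `n`). -/
def HasGorensteinResolution (M : ModuleCat.{u} R) (n : ℕ) : Prop :=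
  ∃ (G : ℕ → ModuleCat.{u} R) (d : ∀ i : ℕ, G (i + 1) →ₗ[R] G i) (ε : G 0 →ₗ[R] M),
    (∀ i : ℕ, i ≤ n → IsGorensteinProjective (G i)) ∧
    (∀ i : ℕ, n < i → Subsingleton (G i)) ∧
    Function.Surjective ε ∧
    Function.Exact (d 0) ε ∧
    ∀ i : ℕ, Function.Exact (d (i + 1)) (d i)

/-- The Gorenstein projective dimension (`⊤` if there is no finite resolution). -/
noncomputable def gorensteinProjDim (M : ModuleCat.{u} R) : ℕ∞ :=
  ⨅ (n : ℕ) (_ : HasGorensteinResolution M n), (n : ℕ∞)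

end Gorenstein

section Stable

variable {R : Type u} [Ring R]

/-- `f` factors through a projective module. -/
def FactorsThroughProjective {M N : ModuleCat.{u} R} (f : M ⟶ N) : Prop :=
  ∃ (P : ModuleCat.{u} R) (a : M ⟶ P) (b : P ⟶ N), Module.Projective R P ∧ a ≫ b = f

theorem FactorsThroughProjective.comp_left {L M N : ModuleCat.{u} R} (e : L ⟶ M) {f : M ⟶ N}
    (hf : FactorsThroughProjective f) : FactorsThroughProjective (e ≫ f) := by
  obtain ⟨P, a, b, hP, rfl⟩ := hf
  exact ⟨P, e ≫ a, b, hP, Category.assoc _ _ _⟩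

theorem FactorsThroughProjective.comp_right {L M N : ModuleCat.{u} R} {f : L ⟶ M} (e : M ⟶ N)
    (hf : FactorsThroughProjective f) : FactorsThroughProjective (f ≫ e) := by
  obtain ⟨P, a, b, hP, rfl⟩ := hf
  exact ⟨P, a, b ≫ e, hP, (Category.assoc _ _ _).symm⟩

theorem FactorsThroughProjective.zero (M N : ModuleCat.{u} R) :
    FactorsThroughProjective (0 : M ⟶ N) :=
  ⟨ModuleCat.of R PUnit.{u + 1}, 0, 0, inferInstanceAs (Module.Projective R PUnit.{u + 1}), by simp⟩

theorem FactorsThroughProjective.neg {M N : ModuleCat.{u} R} {f : M ⟶ N}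
    (hf : FactorsThroughProjective f) : FactorsThroughProjective (-f) := by
  obtain ⟨P, a, b, hP, rfl⟩ := hf
  exact ⟨P, -a, b, hP, Preadditive.neg_comp _ _⟩

theorem FactorsThroughProjective.add {M N : ModuleCat.{u} R} {f g : M ⟶ N}
    (hf : FactorsThroughProjective f) (hg : FactorsThroughProjective g) :
    FactorsThroughProjective (f + g) := by
  obtain ⟨P, a, b, hP, rfl⟩ := hf
  obtain ⟨Q, c, d, hQ, rfl⟩ := hg
  refine ⟨ModuleCat.of R (P × Q), ModuleCat.ofHom (a.hom.prod c.hom),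
    ModuleCat.ofHom (b.hom.coprod d.hom), inferInstanceAs (Module.Projective R (P × Q)), ?_⟩
  ext x
  simp

/-- Two morphisms are identified in the stable category if their difference factors through a
projective module. -/
def stableRel (R : Type u) [Ring R] : HomRel (ModuleCat.{u} R) :=
  fun _ _ f g => FactorsThroughProjective (f - g)

/-- The identification is a congruence, so that the morphisms of the quotient category below are
exactly the groups `Hom(M, N)` modulo the maps that factor through a projective module. -/
instance stableRel_congruence (R : Type u) [Ring R] : Congruence (stableRel R) where
  equivalence :=
    { refl := fun f => by
        simpa [stableRel] using FactorsThroughProjective.zero _ _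
      symm := fun {f g} h => by
        simpa [stableRel] using FactorsThroughProjective.neg h
      trans := fun {f g k} h h' => by
        simpa [stableRel] using FactorsThroughProjective.add h h' }
  comp_left e _ _ h := by
    simpa [stableRel, Preadditive.comp_sub] using FactorsThroughProjective.comp_left e h
  comp_right e h := by
    simpa [stableRel, Preadditive.sub_comp] using FactorsThroughProjective.comp_right e h

/-- The stable category of left `R`-modules. -/
abbrev StableCat (R : Type u) [Ring R] := Quotient (stableRel R)

/-- A module as an object of the stable category. -/
abbrev toStable {R : Type u} [Ring R] (M : ModuleCat.{u} R) : StableCat R :=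
  (Quotient.functor (stableRel R)).obj M

end Stable

end PeriodicDimension

open PeriodicDimension

/-!
For a short exact sequence `0 → A → P → X → 0` with `P` projective, `Ext^{i+1}(X, W)` vanishes
together with `Ext^i(A, W)` for `i > 0`, and `Ext^1(X, W) = 0` exactly when every map `A → W`
extends to `P`. Applied to the pieces of a totally acyclic complex, this shows that a Gorenstein
projective module has no positive `Ext` into projectives `W`; hence `Ext^i(M, W) = 0` for
`i > r = Gpd M` and projective `W` (`HasGorensteinResolution.extVanishesAbove`), and the syzygies
`Ω^i M` with `i ≥ r` have no positive `Ext` into projectives at all. Only this vanishing is used,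
so closure properties of the class of Gorenstein projective modules are not needed.

*Lower bound.* If `N = Ω^n M` is periodic, then `N` is isomorphic to arbitrarily high syzygies of
itself, so its positive `Ext` groups into projectives vanish. Repeating its projective resolution
periodically in both directions therefore gives a totally acyclic complex, so that `N` is Gorenstein
projective (`IsPeriodic.isGorensteinProjective`) and `Gpd M ≤ n`.

*Stable isomorphism.* When `Ext^1` into projectives vanishes on `X` and `X'`, maps between their
syzygies extend to the projective covers and induce maps between `X` and `X'`, uniquely up to maps
factoring through projectives. A stable isomorphism of syzygies thus comes from a stable isomorphism
of the modules (`StablyIsomorphic.of_syzygy`). An isomorphism `Ω^{n+p} M ≅ Ω^n M` with `n ≥ r` then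
descends step by step to a stable isomorphism `Ω^{r+p} M ≅ Ω^r M` (`stablyIsomorphic_nthSyzygy`).

*Upper bound.* Stably isomorphic modules have honestly isomorphic syzygies
(`StablyIsomorphic.nonempty_kernel_equiv`), because an endomorphism of a projective cover that is
the identity modulo the superfluous kernel is bijective
(`IsProjectiveCover.bijective_of_comp_eq`). So `Ω^{r+p+1} M ≅ Ω^{r+1} M`, that is,
`Ω^{r+1} M` is periodic.
-/

namespace PeriodicDimension

/-! ### Vanishing of `Ext` into projective modules -/

section ExtVanishing

variable {R : Type u} [Ring R]

/-- A pair of linear maps `A → B → C` that forms a short exact sequence `0 → A → B → C → 0`. -/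
structure IsShortExact {A B C : ModuleCat.{u} R} (f : A →ₗ[R] B) (g : B →ₗ[R] C) : Prop where
  injective : Function.Injective f
  exact : Function.Exact f g
  surjective : Function.Surjective g

section

variable {A B C : ModuleCat.{u} R} {f : A →ₗ[R] B} {g : B →ₗ[R] C}

theorem IsShortExact.comp_eq_zero (h : IsShortExact f g) : g ∘ₗ f = 0 :=
  h.exact.linearMap_comp_eq_zero

/-- A linear map that kills `A` factors through `C`. -/
theorem IsShortExact.exists_factor (h : IsShortExact f g) {W : ModuleCat.{u} R} {b : B →ₗ[R] W}
    (hb : b ∘ₗ f = 0) : ∃ c : C →ₗ[R] W, c ∘ₗ g = b := by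
  have hle : LinearMap.ker g ≤ LinearMap.ker b := by
    rwa [h.exact.linearMap_ker_eq, LinearMap.range_le_ker_iff]
  refine ⟨(LinearMap.ker g).liftQ b hle ∘ₗ
    (g.quotKerEquivOfSurjective h.surjective).symm.toLinearMap, ?_⟩
  ext x
  have : (g.quotKerEquivOfSurjective h.surjective).symm (g x) = Submodule.Quotient.mk x :=
    (LinearEquiv.symm_apply_eq _).mpr rfl
  simp [this]

/-- The short exact sequence as a short complex of the abelian category of modules. -/
theorem IsShortExact.shortExact (h : IsShortExact f g) :
    (ShortComplex.mk (ModuleCat.ofHom f) (ModuleCat.ofHom g)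
      (by rw [← ModuleCat.ofHom_comp, h.comp_eq_zero]; rfl)).ShortExact where
  exact := (ShortComplex.ShortExact.moduleCat_exact_iff_function_exact _).mpr h.exact
  mono_f := (ModuleCat.mono_iff_injective _).mpr h.injective
  epi_g := (ModuleCat.epi_iff_surjective _).mpr h.surjective

theorem subsingleton_ext_of_projective {P : ModuleCat.{u} R} (hP : Module.Projective R P)
    (W : ModuleCat.{u} R) (i : ℕ) : Subsingleton (Abelian.Ext P W (i + 1)) :=
  Abelian.Ext.subsingleton_of_projective P W i

theorem IsShortExact.subsingleton_ext_right (h : IsShortExact f g) {W : ModuleCat.{u} R} {i : ℕ}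
    (hA : Subsingleton (Abelian.Ext A W i)) (hB : Subsingleton (Abelian.Ext B W (i + 1))) :
    Subsingleton (Abelian.Ext C W (i + 1)) := by
  refine subsingleton_of_forall_eq 0 fun x => ?_
  obtain ⟨y, rfl⟩ := Abelian.Ext.contravariant_sequence_exact₃ h.shortExact W x
    (hB.elim _ _) (add_comm 1 i)
  rw [hA.elim y 0, Abelian.Ext.comp_zero]

theorem IsShortExact.subsingleton_ext_left (h : IsShortExact f g) {W : ModuleCat.{u} R} {i : ℕ}
    (hB : Subsingleton (Abelian.Ext B W i)) (hC : Subsingleton (Abelian.Ext C W (i + 1))) :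
    Subsingleton (Abelian.Ext A W i) := by
  refine subsingleton_of_forall_eq 0 fun x => ?_
  obtain ⟨y, rfl⟩ := Abelian.Ext.contravariant_sequence_exact₁ h.shortExact W x (add_comm 1 i)
    (hC.elim _ _)
  rw [hB.elim y 0, Abelian.Ext.comp_zero]

theorem IsShortExact.exists_extension (h : IsShortExact f g) {W : ModuleCat.{u} R}
    (hC : Subsingleton (Abelian.Ext C W 1)) (a : A →ₗ[R] W) : ∃ b : B →ₗ[R] W, b ∘ₗ f = a := by
  obtain ⟨y, hy⟩ := Abelian.Ext.contravariant_sequence_exact₁ h.shortExact W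
    (Abelian.Ext.mk₀ (ModuleCat.ofHom a)) (add_zero 1) (hC.elim _ _)
  obtain ⟨b, rfl⟩ := Abelian.Ext.mk₀_bijective _ _ |>.surjective y
  rw [Abelian.Ext.mk₀_comp_mk₀] at hy
  exact ⟨b.hom, congrArg ModuleCat.Hom.hom ((Abelian.Ext.mk₀_bijective _ _).injective hy)⟩

theorem IsShortExact.subsingleton_ext_one (h : IsShortExact f g) {W : ModuleCat.{u} R}
    (hB : Module.Projective R B) (hext : ∀ a : A →ₗ[R] W, ∃ b : B →ₗ[R] W, b ∘ₗ f = a) :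
    Subsingleton (Abelian.Ext C W 1) := by
  refine subsingleton_of_forall_eq 0 fun x => ?_
  obtain ⟨y, rfl⟩ := Abelian.Ext.contravariant_sequence_exact₃ h.shortExact W x
    ((subsingleton_ext_of_projective hB W 0).elim _ _) (add_zero 1)
  obtain ⟨a, rfl⟩ := (Abelian.Ext.mk₀_bijective _ _).surjective y
  obtain ⟨b, hb⟩ := hext a.hom
  have : a = ModuleCat.ofHom f ≫ ModuleCat.ofHom b :=
    ModuleCat.hom_ext hb.symm
  rw [this, ← Abelian.Ext.mk₀_comp_mk₀]
  exact h.shortExact.extClass_comp_assoc (Abelian.Ext.mk₀ (ModuleCat.ofHom b))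

end

/-- `Ext^i(X, W) = 0` for every projective module `W` and every `i > k`. -/
def ExtVanishesAbove (X : ModuleCat.{u} R) (k : ℕ) : Prop :=
  ∀ W : ModuleCat.{u} R, Module.Projective R W → ∀ i : ℕ, k ≤ i →
    Subsingleton (Abelian.Ext X W (i + 1))

section

variable {A B C X Y : ModuleCat.{u} R} {f : A →ₗ[R] B} {g : B →ₗ[R] C} {k l : ℕ}

theorem ExtVanishesAbove.mono (h : ExtVanishesAbove X k) (hkl : k ≤ l) : ExtVanishesAbove X l :=
  fun W hW i hi => h W hW i (hkl.trans hi)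

theorem ExtVanishesAbove.of_projective (h : Module.Projective R X) : ExtVanishesAbove X 0 :=
  fun W _ i _ => subsingleton_ext_of_projective h W i

theorem ExtVanishesAbove.of_equiv (h : ExtVanishesAbove X k) (e : X ≃ₗ[R] Y) :
    ExtVanishesAbove Y k := by
  intro W hW i hi
  have hs := h W hW i hi
  refine subsingleton_of_forall_eq 0 fun x => ?_
  have he : 𝟙 Y = e.toModuleIso.inv ≫ e.toModuleIso.hom := e.toModuleIso.inv_hom_id.symm
  rw [← Abelian.Ext.mk₀_id_comp x, he, ← Abelian.Ext.mk₀_comp_mk₀_assoc,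
    hs.elim ((Abelian.Ext.mk₀ e.toModuleIso.hom).comp x _) 0, Abelian.Ext.comp_zero]

theorem ExtVanishesAbove.right (h : IsShortExact f g) (hA : ExtVanishesAbove A k)
    (hB : ExtVanishesAbove B 0) : ExtVanishesAbove C (k + 1) := by
  intro W hW i hi
  obtain ⟨j, rfl⟩ := Nat.exists_eq_add_of_le' hi
  exact h.subsingleton_ext_right (hA W hW (j + k) (by lia)) (hB W hW _ (Nat.zero_le _))

theorem ExtVanishesAbove.left (h : IsShortExact f g) (hC : ExtVanishesAbove C (k + 1))
    (hB : ExtVanishesAbove B 0) : ExtVanishesAbove A k :=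
  fun W hW i hi =>
    h.subsingleton_ext_left (hB W hW i (Nat.zero_le _)) (hC W hW (i + 1) (by lia))

end

end ExtVanishing

/-! ### Gorenstein projective modules and resolutions -/

section GorensteinProjective

variable {R : Type u} [Ring R]

/-- Replacing `Tᵢ₊₁ → Tᵢ` by its cokernel `Zᵢ` cuts an acyclic complex into short exact sequences
`0 → Zᵢ₊₁ → Tᵢ → Zᵢ → 0`. -/
theorem isShortExact_cokernels {A B C : ModuleCat.{u} R} {d' : A →ₗ[R] B} {d : B →ₗ[R] C}
    (h : Function.Exact d' d) :
    IsShortExact (A := ModuleCat.of R (B ⧸ LinearMap.range d')) (B := C)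
      (C := ModuleCat.of R (C ⧸ LinearMap.range d))
      ((LinearMap.range d').liftQ d (LinearMap.range_le_ker_iff.mpr h.linearMap_comp_eq_zero))
      (LinearMap.range d).mkQ where
  injective := by
    rw [← LinearMap.ker_eq_bot]
    exact Submodule.ker_liftQ_eq_bot _ _ _ h.linearMap_ker_eq.le
  exact := by
    rw [LinearMap.exact_iff, Submodule.ker_mkQ, Submodule.range_liftQ]
  surjective := Submodule.mkQ_surjective _

theorem IsTotallyAcyclic.exact {T : ChainComplex (ModuleCat.{u} R) ℤ} (hT : IsTotallyAcyclic T)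
    (i : ℤ) : Function.Exact (T.d (i + 1 + 1) (i + 1)).hom (T.d (i + 1) i).hom := by
  have h := (T.exactAt_iff' (i + 1 + 1) (i + 1) i (by simp) (by simp)).mp (hT.acyclic (i + 1))
  exact (ShortComplex.ShortExact.moduleCat_exact_iff_function_exact _).mp h

theorem IsTotallyAcyclic.subsingleton_ext {T : ChainComplex (ModuleCat.{u} R) ℤ}
    (hT : IsTotallyAcyclic T) {W : ModuleCat.{u} R} (hW : Module.Projective R W) (n : ℕ) :
    ∀ i : ℤ, Subsingleton (Abelian.Ext
      (ModuleCat.of R (T.X i ⧸ LinearMap.range (T.d (i + 1) i).hom)) W (n + 1)) := by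
  induction n with
  | zero =>
    intro i
    refine (isShortExact_cokernels (hT.exact i)).subsingleton_ext_one (hT.projective i)
      fun a => ?_
    have hexact := hT.hom_acyclic W hW i
    rw [show i + 2 = i + 1 + 1 by ring] at hexact
    obtain ⟨b, hb⟩ := (hexact (ModuleCat.ofHom (a ∘ₗ Submodule.mkQ _))).mp
      (ModuleCat.hom_ext (LinearMap.ext fun x => by
        have : Submodule.Quotient.mk (p := LinearMap.range (T.d (i + 1 + 1) (i + 1)).hom)
            ((T.d (i + 1 + 1) (i + 1)).hom x) = 0 :=
          (Submodule.Quotient.mk_eq_zero _).mpr ⟨x, rfl⟩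
        exact (congrArg a this).trans (map_zero a)))
    refine ⟨b.hom, Submodule.linearMap_qext _ ?_⟩
    exact congrArg ModuleCat.Hom.hom hb
  | succ n ih =>
    exact fun i => (isShortExact_cokernels (hT.exact i)).subsingleton_ext_right (ih (i + 1))
      (subsingleton_ext_of_projective (hT.projective i) W _)

theorem IsGorensteinProjective.extVanishesAbove {G : ModuleCat.{u} R}
    (hG : IsGorensteinProjective G) : ExtVanishesAbove G 0 := by
  obtain ⟨T, hT, ⟨e⟩⟩ := hG
  exact ExtVanishesAbove.of_equiv (X := ModuleCat.of R (T.X 0 ⧸ LinearMap.range (T.d 1 0).hom))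
    (fun W hW i _ => hT.subsingleton_ext hW i 0) e

/-- Splicing: a doubly infinite family of short exact sequences `0 → Zᵢ₊₁ → Pᵢ → Zᵢ → 0` with
`Pᵢ` projective, along which maps from `Zᵢ₊₁` to projective modules extend to `Pᵢ`, exhibits
`Z₀` as a Gorenstein projective module. -/
theorem isGorensteinProjective_of_shortExact (Z P : ℤ → ModuleCat.{u} R)
    (ι : ∀ i, Z (i + 1) →ₗ[R] P i) (π : ∀ i, P i →ₗ[R] Z i)
    (hP : ∀ i, Module.Projective R (P i)) (hex : ∀ i, IsShortExact (ι i) (π i))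
    (hext : ∀ (W : ModuleCat.{u} R), Module.Projective R W → ∀ i (a : Z (i + 1) →ₗ[R] W),
      ∃ b : P i →ₗ[R] W, b ∘ₗ ι i = a) :
    IsGorensteinProjective (Z 0) := by
  let d : ∀ i, P (i + 1) ⟶ P i := fun i => ModuleCat.ofHom (ι i ∘ₗ π (i + 1))
  have hker : ∀ i, LinearMap.ker (ι i ∘ₗ π (i + 1)) = LinearMap.range (ι (i + 1)) := fun i => by
    rw [LinearMap.ker_comp_of_ker_eq_bot _ (LinearMap.ker_eq_bot.mpr (hex i).injective)]
    exact (hex (i + 1)).exact.linearMap_ker_eq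
  have hrange : ∀ i, LinearMap.range (ι i ∘ₗ π (i + 1)) = LinearMap.range (ι i) := fun i =>
    LinearMap.range_comp_of_range_eq_top _ (LinearMap.range_eq_top.mpr (hex (i + 1)).surjective)
  have hd : ∀ i, d (i + 1) ≫ d i = 0 := fun i => ModuleCat.hom_ext <| LinearMap.ext fun x => by
    have : π (i + 1) (ι (i + 1) (π (i + 1 + 1) x)) = 0 := (hex (i + 1)).exact.apply_apply_eq_zero _
    exact (congrArg (ι i) this).trans (map_zero _)
  let T : ChainComplex (ModuleCat.{u} R) ℤ := ChainComplex.of P d hd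
  have hTd : ∀ i, T.d (i + 1) i = d i := fun i => ChainComplex.of_d P d i
  refine ⟨T, ⟨hP, fun j => ?_, fun W hW i => ?_⟩, ?_⟩
  · obtain ⟨i, rfl⟩ : ∃ i, j = i + 1 := ⟨j - 1, by ring⟩
    rw [T.exactAt_iff' (i + 1 + 1) (i + 1) i (by simp) (by simp)]
    refine (ShortComplex.ShortExact.moduleCat_exact_iff_function_exact _).mpr ?_
    change Function.Exact (T.d (i + 1 + 1) (i + 1)).hom (T.d (i + 1) i).hom
    rw [hTd, hTd]
    exact LinearMap.exact_iff.mpr ((hker i).trans (hrange (i + 1)).symm)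
  · rw [show i + 2 = i + 1 + 1 by ring, hTd, hTd]
    intro g
    constructor
    · intro hg
      -- `g` kills the image of `Zᵢ₊₂`, so it descends to `Zᵢ₊₁`, from where it extends to `Pᵢ`.
      obtain ⟨a, ha⟩ := (hex (i + 1)).exists_factor (b := g.hom) <| by
        rw [← LinearMap.range_le_ker_iff, ← hrange (i + 1), LinearMap.range_le_ker_iff]
        exact congrArg ModuleCat.Hom.hom hg
      obtain ⟨b, hb⟩ := hext W hW i a
      refine ⟨ModuleCat.ofHom b, ModuleCat.hom_ext ?_⟩
      rw [← ha, ← hb]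
      rfl
    · rintro ⟨b, rfl⟩
      change d (i + 1) ≫ d i ≫ b = 0
      rw [← Category.assoc, hd, Limits.zero_comp]
  · have h0 : LinearMap.range (T.d 1 0).hom = LinearMap.ker (π 0) := by
      rw [(hex 0).exact.linearMap_ker_eq, ← hrange 0]
      exact congrArg (fun f => LinearMap.range (ModuleCat.Hom.hom f)) (hTd 0)
    exact ⟨(Submodule.quotEquivOfEq _ _ h0).trans
      ((π 0).quotKerEquivOfSurjective (hex 0).surjective)⟩

/-- A projective module `P` is spliced from the split sequences `0 → P → P × P → P → 0`. -/
theorem isGorensteinProjective_of_projective {P : ModuleCat.{u} R} (hP : Module.Projective R P) :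
    IsGorensteinProjective P :=
  isGorensteinProjective_of_shortExact (fun _ => P) (fun _ => ModuleCat.of R (P × P))
    (fun _ => LinearMap.inr R P P) (fun _ => LinearMap.fst R P P)
    (fun _ => inferInstanceAs (Module.Projective R (P × P)))
    (fun _ => ⟨LinearMap.inr_injective, Function.Exact.inr_fst, LinearMap.fst_surjective⟩)
    (fun _ _ _ a => ⟨a ∘ₗ LinearMap.snd R P P, by ext x; rfl⟩)

/-- Dimension shifting along a Gorenstein projective resolution. -/
theorem HasGorensteinResolution.extVanishesAbove {n : ℕ} : ∀ {M : ModuleCat.{u} R},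
    HasGorensteinResolution M n → ExtVanishesAbove M n := by
  induction n with
  | zero =>
    rintro M ⟨G, d, ε, hG, hzero, hε, hex, -⟩
    have hinj : Function.Injective ε := by
      have := hzero 1 one_pos
      rw [← LinearMap.ker_eq_bot, hex.linearMap_ker_eq, LinearMap.range_eq_bot]
      exact Subsingleton.elim _ _
    exact (hG 0 le_rfl).extVanishesAbove.of_equiv (LinearEquiv.ofBijective ε ⟨hinj, hε⟩)
  | succ n ih =>
    rintro M ⟨G, d, ε, hG, hzero, hε, hex, hexs⟩
    -- The kernel of `ε` is resolved by the tail of the given resolution.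
    refine ExtVanishesAbove.right (A := ModuleCat.of R (LinearMap.ker ε)) (B := G 0)
      ⟨Submodule.subtype_injective _, LinearMap.exact_subtype_ker_map ε, hε⟩
      (ih ⟨fun i => G (i + 1), fun i => d (i + 1),
        (d 0).codRestrict _ fun x => hex.apply_apply_eq_zero x,
        fun i hi => hG _ (by lia), fun i hi => hzero _ (by lia), ?_, ?_, fun i => hexs (i + 1)⟩)
      (hG 0 (Nat.zero_le _)).extVanishesAbove
    · rintro ⟨x, hx⟩
      obtain ⟨y, rfl⟩ := (hex x).mp hx
      exact ⟨y, rfl⟩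
    · exact fun x => Subtype.ext_iff.trans (hexs 0 x)

end GorensteinProjective

/-! ### Stable isomorphisms and syzygies -/

section StableMaps

variable {R : Type u} [Ring R]

/-- A linear map that is zero in the stable category: it factors through a projective module. -/
def IsStablyZero {X Y : ModuleCat.{u} R} (f : X →ₗ[R] Y) : Prop :=
  ∃ (P : ModuleCat.{u} R) (a : X →ₗ[R] P) (b : P →ₗ[R] Y), Module.Projective R P ∧ b ∘ₗ a = f

/-- There are linear maps in both directions that are mutually inverse up to maps that factor
through a projective module. -/
def StablyIsomorphic (X Y : ModuleCat.{u} R) : Prop :=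
  ∃ (f : X →ₗ[R] Y) (g : Y →ₗ[R] X),
    IsStablyZero (g ∘ₗ f - LinearMap.id) ∧ IsStablyZero (f ∘ₗ g - LinearMap.id)

variable {X Y : ModuleCat.{u} R}

theorem IsStablyZero.zero : IsStablyZero (0 : X →ₗ[R] Y) :=
  ⟨ModuleCat.of R PUnit.{u + 1}, 0, 0, inferInstanceAs (Module.Projective R PUnit.{u + 1}), by simp⟩

theorem StablyIsomorphic.of_equiv (e : X ≃ₗ[R] Y) : StablyIsomorphic X Y :=
  ⟨e, e.symm, by simpa using IsStablyZero.zero, by simpa using IsStablyZero.zero⟩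

theorem StablyIsomorphic.toStable (h : StablyIsomorphic X Y) :
    Nonempty (toStable X ≅ toStable Y) := by
  obtain ⟨f, g, ⟨P, a, b, hP, hab⟩, ⟨Q, c, d, hQ, hcd⟩⟩ := h
  refine ⟨⟨(Quotient.functor (stableRel R)).map (ModuleCat.ofHom f),
    (Quotient.functor (stableRel R)).map (ModuleCat.ofHom g), ?_, ?_⟩⟩
  · rw [← Functor.map_comp, ← (Quotient.functor (stableRel R)).map_id,
      Quotient.functor_map_eq_iff]
    exact ⟨P, ModuleCat.ofHom a, ModuleCat.ofHom b, hP, ModuleCat.hom_ext hab⟩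
  · rw [← Functor.map_comp, ← (Quotient.functor (stableRel R)).map_id,
      Quotient.functor_map_eq_iff]
    exact ⟨Q, ModuleCat.ofHom c, ModuleCat.ofHom d, hQ, ModuleCat.hom_ext hcd⟩

section

variable {A P X A' P' X' : ModuleCat.{u} R} {i : A →ₗ[R] P} {q : P →ₗ[R] X}
  {i' : A' →ₗ[R] P'} {q' : P' →ₗ[R] X'}

/-- A map of syzygies extends to a map of short exact sequences, since `Ext^1(X, P') = 0`. -/
theorem IsShortExact.exists_map (h : IsShortExact i q) (h' : IsShortExact i' q')
    (hX : ExtVanishesAbove X 0) (hP' : Module.Projective R P') (f : A →ₗ[R] A') :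
    ∃ (φ : P →ₗ[R] P') (F : X →ₗ[R] X'), φ ∘ₗ i = i' ∘ₗ f ∧ F ∘ₗ q = q' ∘ₗ φ := by
  obtain ⟨φ, hφ⟩ := h.exists_extension (hX P' hP' 0 le_rfl) (i' ∘ₗ f)
  obtain ⟨F, hF⟩ := h.exists_factor (b := q' ∘ₗ φ) (by
    rw [LinearMap.comp_assoc, hφ, ← LinearMap.comp_assoc, h'.comp_eq_zero, LinearMap.zero_comp])
  exact ⟨φ, F, hφ, hF⟩

/-- If the map induced on syzygies is stably zero, then so is the map itself: a factorization
`A → W → A'` extends to `P → W → P'`, and what remains of `φ` descends to a lift `X → P'` of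
`F`. -/
theorem IsShortExact.isStablyZero_of_syzygy (h : IsShortExact i q) (h' : IsShortExact i' q')
    (hX : ExtVanishesAbove X 0) (hP' : Module.Projective R P') {f : A →ₗ[R] A'}
    {φ : P →ₗ[R] P'} {F : X →ₗ[R] X'} (hφ : φ ∘ₗ i = i' ∘ₗ f) (hF : F ∘ₗ q = q' ∘ₗ φ)
    (hf : IsStablyZero f) : IsStablyZero F := by
  obtain ⟨W, a, b, hW, rfl⟩ := hf
  obtain ⟨c, hc⟩ := h.exists_extension (hX W hW 0 le_rfl) a
  obtain ⟨s, hs⟩ := h.exists_factor (b := φ - i' ∘ₗ b ∘ₗ c) (by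
    rw [LinearMap.sub_comp, hφ, LinearMap.comp_assoc, LinearMap.comp_assoc, hc, sub_self])
  refine ⟨P', s, q', hP', (LinearMap.cancel_right h.surjective).mp ?_⟩
  rw [LinearMap.comp_assoc, hs, LinearMap.comp_sub, hF, ← LinearMap.comp_assoc, h'.comp_eq_zero,
    LinearMap.zero_comp, sub_zero]

/-- If the positive `Ext` groups of `X` and `X'` into projectives vanish, then a stable isomorphism
between their syzygies comes from a stable isomorphism between `X` and `X'`. -/
theorem StablyIsomorphic.of_syzygy (h : IsShortExact i q) (h' : IsShortExact i' q')
    (hP : Module.Projective R P) (hP' : Module.Projective R P')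
    (hX : ExtVanishesAbove X 0) (hX' : ExtVanishesAbove X' 0)
    (hA : StablyIsomorphic A A') : StablyIsomorphic X X' := by
  obtain ⟨f, g, hgf, hfg⟩ := hA
  obtain ⟨φ, F, hφ, hF⟩ := h.exists_map h' hX hP' f
  obtain ⟨ψ, G, hψ, hG⟩ := h'.exists_map h hX' hP g
  refine ⟨F, G,
    h.isStablyZero_of_syzygy h hX hP (φ := ψ ∘ₗ φ - LinearMap.id) ?_ ?_ hgf,
    h'.isStablyZero_of_syzygy h' hX' hP' (φ := φ ∘ₗ ψ - LinearMap.id) ?_ ?_ hfg⟩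
  · rw [LinearMap.sub_comp, LinearMap.comp_sub, LinearMap.comp_assoc, hφ, ← LinearMap.comp_assoc,
      hψ, LinearMap.comp_assoc, LinearMap.id_comp, LinearMap.comp_id]
  · rw [LinearMap.sub_comp, LinearMap.comp_sub, LinearMap.comp_assoc, hF, ← LinearMap.comp_assoc,
      hG, LinearMap.comp_assoc, LinearMap.id_comp, LinearMap.comp_id]
  · rw [LinearMap.sub_comp, LinearMap.comp_sub, LinearMap.comp_assoc, hψ, ← LinearMap.comp_assoc,
      hφ, LinearMap.comp_assoc, LinearMap.id_comp, LinearMap.comp_id]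
  · rw [LinearMap.sub_comp, LinearMap.comp_sub, LinearMap.comp_assoc, hG, ← LinearMap.comp_assoc,
      hF, LinearMap.comp_assoc, LinearMap.id_comp, LinearMap.comp_id]

end

/-- Let `π : P → X` be a projective cover. An endomorphism `θ` of `P` that is the identity modulo
`ker π` is bijective: its range and `ker π` span `P`, so it is surjective; the range of a section
and `ker π` span `P` as well, so the section is surjective too. -/
theorem IsProjectiveCover.bijective_of_comp_eq {P X : ModuleCat.{u} R} {π : P →ₗ[R] X}
    (h : IsProjectiveCover π) {θ : P →ₗ[R] P} (hθ : π ∘ₗ θ = π) : Function.Bijective θ := by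
  have hmem : ∀ x, x - θ x ∈ LinearMap.ker π := fun x => by
    rw [LinearMap.mem_ker, map_sub, sub_eq_zero]
    exact (LinearMap.congr_fun hθ x).symm
  have hsurj : Function.Surjective θ := by
    refine LinearMap.range_eq_top.mp (h.superfluous _ (eq_top_iff.mpr fun x _ => ?_))
    exact Submodule.mem_sup.mpr ⟨θ x, ⟨x, rfl⟩, x - θ x, hmem x, by abel⟩
  refine ⟨?_, hsurj⟩
  have := h.projective
  obtain ⟨σ, hσ⟩ := Module.projective_lifting_property θ LinearMap.id hsurj
  have hσ' : ∀ x, θ (σ x) = x := LinearMap.congr_fun hσ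
  have hrange : LinearMap.range σ = ⊤ := by
    refine h.superfluous _ (eq_top_iff.mpr fun x _ => ?_)
    refine Submodule.mem_sup.mpr ⟨σ (θ x), ⟨_, rfl⟩, x - σ (θ x), ?_, by abel⟩
    have := hmem (x - σ (θ x))
    rwa [map_sub, hσ', sub_self, sub_zero] at this
  intro x y hxy
  obtain ⟨x, rfl⟩ := LinearMap.range_eq_top.mp hrange x
  obtain ⟨y, rfl⟩ := LinearMap.range_eq_top.mp hrange y
  rw [hσ', hσ'] at hxy
  rw [hxy]

section

variable {A P X A' P' X' : ModuleCat.{u} R} {i : A →ₗ[R] P} {q : P →ₗ[R] X}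
  {i' : A' →ₗ[R] P'} {q' : P' →ₗ[R] X'}

/-- A map that is stably the identity lifts to a map of projective covers that is bijective on
syzygies: after subtracting a lift that factors through `X → W → P`, which vanishes on the
syzygy, the lift is the identity modulo the superfluous kernel. -/
theorem IsShortExact.bijective_of_isStablyZero_sub_id (h : IsShortExact i q)
    (hq : IsProjectiveCover q) {f : X →ₗ[R] X} (hf : IsStablyZero (f - LinearMap.id))
    {φ : P →ₗ[R] P} (hφ : q ∘ₗ φ = f ∘ₗ q) {κ : A →ₗ[R] A} (hκ : i ∘ₗ κ = φ ∘ₗ i) :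
    Function.Bijective κ := by
  obtain ⟨W, a, b, hW, hab⟩ := hf
  obtain ⟨c, hc⟩ := Module.projective_lifting_property q b h.surjective
  let θ : P →ₗ[R] P := φ - c ∘ₗ a ∘ₗ q
  have hθ : q ∘ₗ θ = q := by
    rw [LinearMap.comp_sub, hφ, ← LinearMap.comp_assoc, ← LinearMap.comp_assoc, hc, hab,
      LinearMap.sub_comp, LinearMap.id_comp, sub_sub_cancel]
  have hbij := hq.bijective_of_comp_eq hθ
  have hκθ : ∀ x, i (κ x) = θ (i x) := LinearMap.congr_fun (f := i ∘ₗ κ) (g := θ ∘ₗ i) <| by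
    rw [hκ, LinearMap.sub_comp, LinearMap.comp_assoc, LinearMap.comp_assoc, h.comp_eq_zero,
      LinearMap.comp_zero, LinearMap.comp_zero, sub_zero]
  constructor
  · intro x y hxy
    refine h.injective (hbij.injective ?_)
    rw [← hκθ x, ← hκθ y, hxy]
  · intro y
    obtain ⟨z, hz⟩ := hbij.surjective (i y)
    obtain ⟨x, rfl⟩ := (h.exact z).mp <| by
      rw [← LinearMap.congr_fun hθ z, LinearMap.comp_apply, hz, h.exact.apply_apply_eq_zero]
    exact ⟨x, h.injective ((hκθ x).trans hz)⟩

/-- A map between `X` and `X'` lifts to a map of short exact sequences. -/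
theorem IsShortExact.exists_lift (h : IsShortExact i q) (h' : IsShortExact i' q')
    (hP : Module.Projective R P) (f : X →ₗ[R] X') :
    ∃ (φ : P →ₗ[R] P') (κ : A →ₗ[R] A'), q' ∘ₗ φ = f ∘ₗ q ∧ i' ∘ₗ κ = φ ∘ₗ i := by
  obtain ⟨φ, hφ⟩ := Module.projective_lifting_property q' (f ∘ₗ q) h'.surjective
  have hmem : ∀ x, φ (i x) ∈ LinearMap.range i' := fun x => by
    rw [← h'.exact.linearMap_ker_eq, LinearMap.mem_ker, ← LinearMap.comp_apply, hφ,
      LinearMap.comp_apply, h.exact.apply_apply_eq_zero, map_zero]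
  let e := LinearEquiv.ofInjective i' h'.injective
  refine ⟨φ, e.symm.toLinearMap ∘ₗ (φ ∘ₗ i).codRestrict (LinearMap.range i') hmem, hφ, ?_⟩
  ext x
  exact congrArg Subtype.val (e.apply_symm_apply ⟨φ (i x), hmem x⟩)

/-- Stably isomorphic modules have isomorphic kernels of projective covers. -/
theorem StablyIsomorphic.nonempty_kernel_equiv (h : IsShortExact i q) (h' : IsShortExact i' q')
    (hq : IsProjectiveCover q) (hq' : IsProjectiveCover q') (hX : StablyIsomorphic X X') :
    Nonempty (A ≃ₗ[R] A') := by
  obtain ⟨f, g, hgf, hfg⟩ := hX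
  obtain ⟨φ, κ, hφ, hκ⟩ := h.exists_lift h' hq.projective f
  obtain ⟨ψ, μ, hψ, hμ⟩ := h'.exists_lift h hq'.projective g
  have h₁ : Function.Bijective (μ ∘ₗ κ) :=
    h.bijective_of_isStablyZero_sub_id hq hgf (φ := ψ ∘ₗ φ)
      (by rw [← LinearMap.comp_assoc, hψ, LinearMap.comp_assoc, hφ, LinearMap.comp_assoc])
      (by rw [← LinearMap.comp_assoc, hμ, LinearMap.comp_assoc, hκ, LinearMap.comp_assoc])
  have h₂ : Function.Bijective (κ ∘ₗ μ) :=
    h'.bijective_of_isStablyZero_sub_id hq' hfg (φ := φ ∘ₗ ψ)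
      (by rw [← LinearMap.comp_assoc, hφ, LinearMap.comp_assoc, hψ, LinearMap.comp_assoc])
      (by rw [← LinearMap.comp_assoc, hκ, LinearMap.comp_assoc, hμ, LinearMap.comp_assoc])
  rw [LinearMap.coe_comp] at h₁ h₂
  exact ⟨LinearEquiv.ofBijective κ ⟨h₁.injective.of_comp, h₂.surjective.of_comp⟩⟩

end

end StableMaps

/-! ### Iterated syzygies over a left perfect ring -/

section Syzygies

variable {R : Type u} [Ring R] [IsLeftPerfect R]

/-- The inclusion of the syzygy of `M` into the chosen projective cover of `M`. -/
noncomputable def syzygyInclusion (M : ModuleCat.{u} R) : syzygy M →ₗ[R] coverObj M :=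
  (LinearMap.ker (coverMap M)).subtype

theorem isShortExact_syzygy (M : ModuleCat.{u} R) :
    IsShortExact (syzygyInclusion M) (coverMap M) :=
  ⟨Submodule.subtype_injective _, LinearMap.exact_subtype_ker_map _,
    (isProjectiveCover_coverMap M).surjective⟩

theorem StablyIsomorphic.nonempty_syzygy_equiv {X Y : ModuleCat.{u} R}
    (h : StablyIsomorphic X Y) : Nonempty (syzygy X ≃ₗ[R] syzygy Y) :=
  h.nonempty_kernel_equiv (isShortExact_syzygy X) (isShortExact_syzygy Y)
    (isProjectiveCover_coverMap X) (isProjectiveCover_coverMap Y)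

theorem nonempty_nthSyzygy_equiv {X Y : ModuleCat.{u} R} (e : X ≃ₗ[R] Y) :
    ∀ k : ℕ, Nonempty (nthSyzygy X k ≃ₗ[R] nthSyzygy Y k)
  | 0 => ⟨e⟩
  | k + 1 =>
    let ⟨e'⟩ := nonempty_nthSyzygy_equiv e k
    (StablyIsomorphic.of_equiv e').nonempty_syzygy_equiv

theorem nthSyzygy_nthSyzygy (M : ModuleCat.{u} R) (m : ℕ) :
    ∀ k : ℕ, nthSyzygy (nthSyzygy M m) k = nthSyzygy M (m + k)
  | 0 => rfl
  | k + 1 => congrArg syzygy (nthSyzygy_nthSyzygy M m k)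

theorem ExtVanishesAbove.syzygy {M : ModuleCat.{u} R} {k : ℕ} (h : ExtVanishesAbove M (k + 1)) :
    ExtVanishesAbove (syzygy M) k :=
  h.left (isShortExact_syzygy M) (.of_projective (isProjectiveCover_coverMap M).projective)

theorem ExtVanishesAbove.nthSyzygy {k : ℕ} {M : ModuleCat.{u} R} (h : ExtVanishesAbove M k) :
    ∀ i : ℕ, ExtVanishesAbove (nthSyzygy M i) (k - i)
  | 0 => h
  | i + 1 => ((h.nthSyzygy i).mono (by lia)).syzygy

/-- A periodic module whose positive `Ext` groups into projectives vanish is Gorenstein projective: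
the projective covers of its syzygies, repeated with its period in both directions, form a totally
acyclic complex. -/
theorem IsPeriodic.isGorensteinProjective {N : ModuleCat.{u} R} (hN : IsPeriodic N)
    (hext : ExtVanishesAbove N 0) : IsGorensteinProjective N := by
  obtain ⟨p, hp, ⟨e⟩⟩ := hN
  let Z : ℤ → ModuleCat.{u} R := fun i => nthSyzygy N (i % p).toNat
  have hZ : ∀ i, Nonempty (Z (i + 1) ≃ₗ[R] syzygy (Z i)) := fun i => by
    have h0 : 0 ≤ i % p := Int.emod_nonneg _ (by lia)
    have hlt : i % p < p := Int.emod_lt_of_pos _ (by lia)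
    rcases eq_or_ne (i % p + 1) p with h | h
    · -- The sequence wraps around: `Zᵢ₊₁ = N ≅ Ωᵖ N = Ω Zᵢ`.
      have h1 : ((i + 1) % p).toNat = 0 := by
        rw [← Int.emod_add_emod, h, Int.emod_self, Int.toNat_zero]
      have h2 : (i % p).toNat + 1 = p := by lia
      change Nonempty (nthSyzygy N ((i + 1) % p).toNat ≃ₗ[R] nthSyzygy N ((i % p).toNat + 1))
      rw [h1, h2]
      exact ⟨e.symm⟩
    · have h1 : ((i + 1) % p).toNat = (i % p).toNat + 1 := by
        rw [← Int.emod_add_emod, Int.emod_eq_of_lt (by lia) (by lia)]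
        lia
      change Nonempty (nthSyzygy N ((i + 1) % p).toNat ≃ₗ[R] nthSyzygy N ((i % p).toNat + 1))
      rw [h1]
      exact ⟨LinearEquiv.refl _ _⟩
  let eZ : ∀ i, Z (i + 1) ≃ₗ[R] syzygy (Z i) := fun i => (hZ i).some
  have hex : ∀ i, IsShortExact (syzygyInclusion (Z i) ∘ₗ (eZ i).toLinearMap)
      (coverMap (Z i)) := fun i =>
    have h := isShortExact_syzygy (Z i)
    ⟨h.injective.comp (eZ i).injective, fun x => by
      rw [h.exact x]
      exact (eZ i).surjective.range_comp _ ▸ Iff.rfl, h.surjective⟩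
  have h0 : Z 0 = N := by simp [Z, nthSyzygy]
  rw [← h0]
  refine isGorensteinProjective_of_shortExact Z (fun i => coverObj (Z i)) _ _
    (fun i => (isProjectiveCover_coverMap (Z i)).projective) hex fun W hW i a => ?_
  exact (hex i).exists_extension
    ((hext.nthSyzygy (i % p).toNat).mono (Nat.zero_sub _).le W hW 0 le_rfl) a

/-- A Gorenstein projective resolution of `Ω M`, prolonged by the projective cover of `M`, resolves
`M`. -/
theorem HasGorensteinResolution.of_syzygy {M : ModuleCat.{u} R} {n : ℕ}
    (h : HasGorensteinResolution (syzygy M) n) : HasGorensteinResolution M (n + 1) := by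
  obtain ⟨G, d, ε, hG, hzero, hε, hex, hexs⟩ := h
  have hM := isShortExact_syzygy M
  let G' : ℕ → ModuleCat.{u} R
    | 0 => coverObj M
    | i + 1 => G i
  let d' : ∀ i : ℕ, (G' (i + 1) : Type u) →ₗ[R] (G' i : Type u)
    | 0 => syzygyInclusion M ∘ₗ ε
    | i + 1 => d i
  refine ⟨G', d', coverMap M, ?_, ?_, hM.surjective, ?_, ?_⟩
  · rintro (_ | i) hi
    · exact isGorensteinProjective_of_projective (isProjectiveCover_coverMap M).projective
    · exact hG i (by lia)
  · rintro (_ | i) hi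
    · lia
    · exact hzero i (by lia)
  · intro x
    rw [hM.exact x]
    exact hε.range_comp _ ▸ Iff.rfl
  · rintro (_ | i)
    · intro x
      refine Iff.trans ?_ (hex x)
      exact map_eq_zero_iff _ hM.injective
    · exact hexs i

theorem hasGorensteinResolution_of_nthSyzygy {n : ℕ} : ∀ {M : ModuleCat.{u} R},
    IsGorensteinProjective (nthSyzygy M n) → HasGorensteinResolution M n := by
  induction n with
  | zero =>
    intro M hM
    refine ⟨fun i => Nat.casesOn i M fun _ => ModuleCat.of R PUnit, fun _ => 0, LinearMap.id,
      ?_, ?_, Function.surjective_id, ?_, ?_⟩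
    · intro i hi
      obtain rfl : i = 0 := by lia
      exact hM
    · rintro (_ | i) hi
      · lia
      · exact inferInstanceAs (Subsingleton PUnit)
    · exact fun x => ⟨fun hx => ⟨0, hx.symm⟩, fun ⟨_, hx⟩ => hx.symm⟩
    · exact fun i x => ⟨fun _ => ⟨0, Subsingleton.elim (α := PUnit) _ _⟩, fun _ => rfl⟩
  | succ n ih =>
    intro M hM
    refine (ih (M := syzygy M) ?_).of_syzygy
    have := nthSyzygy_nthSyzygy M 1 n
    rw [add_comm 1 n] at this
    exact this ▸ hM

end Syzygies

/-! ### Periodic syzygies -/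

/-- A finite infimum of natural numbers in `ℕ∞` is attained. -/
theorem of_iInf_natCast_eq {p : ℕ → Prop} {k : ℕ} (h : ⨅ (n : ℕ) (_ : p n), (n : ℕ∞) = k) :
    p k := by
  classical
  have hex : ∃ n, p n := by
    by_contra! hne
    simp [hne] at h
  have hle : ⨅ (n : ℕ) (_ : p n), (n : ℕ∞) = Nat.find hex :=
    le_antisymm (iInf₂_le _ (Nat.find_spec hex))
      (le_iInf₂ fun n hn => Nat.cast_le.mpr (Nat.find_min' hex hn))
  rw [Nat.cast_inj.mp (h.symm.trans hle)]
  exact Nat.find_spec hex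

section PeriodicSyzygies

variable {R : Type u} [Ring R] [IsLeftPerfect R] {M : ModuleCat.{u} R} {r n p : ℕ}

/-- If `Ext^i(M, W) = 0` for projective `W` and `i > r`, then an isomorphism `Ω^{n+p} M ≅ Ω^n M` with
`n ≥ r` descends, one syzygy at a time, to a stable isomorphism `Ω^{r+p} M ≅ Ω^r M`. -/
theorem stablyIsomorphic_nthSyzygy (hM : ExtVanishesAbove M r) (hrn : r ≤ n)
    (e : nthSyzygy M (n + p) ≃ₗ[R] nthSyzygy M n) :
    StablyIsomorphic (nthSyzygy M (r + p)) (nthSyzygy M r) := by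
  have hvanish : ∀ i, r ≤ i → ExtVanishesAbove (nthSyzygy M i) 0 := fun i hi =>
    (hM.nthSyzygy i).mono (by lia)
  refine Nat.decreasingInduction' (P := fun m => StablyIsomorphic (nthSyzygy M (m + p))
    (nthSyzygy M m)) (fun k _ hk ih => ?_) hrn (.of_equiv e)
  rw [Nat.add_right_comm] at ih
  exact .of_syzygy (isShortExact_syzygy _) (isShortExact_syzygy _)
    (isProjectiveCover_coverMap _).projective (isProjectiveCover_coverMap _).projective
    (hvanish _ (by lia)) (hvanish _ hk) ih

/-- If `Ext` of a periodic module vanishes above some degree, then it vanishes in all positive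
degrees, because the module is isomorphic to arbitrarily high syzygies of itself. -/
theorem IsPeriodic.extVanishesAbove {N : ModuleCat.{u} R} (hN : IsPeriodic N)
    (h : ExtVanishesAbove N r) : ExtVanishesAbove N 0 := by
  obtain ⟨p, hp, ⟨e⟩⟩ := hN
  have hiter : ∀ k : ℕ, Nonempty (nthSyzygy N (p * k) ≃ₗ[R] N) := fun k => by
    induction k with
    | zero => exact ⟨LinearEquiv.refl _ _⟩
    | succ k ih =>
      obtain ⟨e'⟩ := ih
      obtain ⟨e''⟩ := nonempty_nthSyzygy_equiv e (p * k)
      rw [nthSyzygy_nthSyzygy, add_comm, ← Nat.mul_succ] at e''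
      exact ⟨e''.trans e'⟩
  obtain ⟨e'⟩ := hiter r
  exact ((h.nthSyzygy (p * r)).mono
    (Nat.sub_eq_zero_of_le (Nat.le_mul_of_pos_left r hp)).le).of_equiv e'

end PeriodicSyzygies

end PeriodicDimension

theorem theorem3p8 (R : Type u) [Ring R] [IsLeftPerfect R] (M : ModuleCat.{u} R)
    (hM : IsEventuallyPeriodic M) (r : ℕ) (hr : gorensteinProjDim M = (r : ℕ∞)) :
    ((r : ℕ∞) ≤ perDim M ∧ perDim M ≤ (r : ℕ∞) + 1) ∧
      ∀ n p : ℕ, perDim M = (n : ℕ∞) → period (nthSyzygy M n) = p →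
        Nonempty (toStable (nthSyzygy M (r + p)) ≅ toStable (nthSyzygy M r)) := by
  have hext : ExtVanishesAbove M r := (of_iInf_natCast_eq hr).extVanishesAbove
  have hle : ∀ n, IsPeriodic (nthSyzygy M n) → r ≤ n := fun n hn => by
    have h : HasGorensteinResolution M n := hasGorensteinResolution_of_nthSyzygy
      (hn.isGorensteinProjective
        (hn.extVanishesAbove ((hext.nthSyzygy n).mono (Nat.sub_le r n))))
    exact Nat.cast_le.mp (hr.symm.le.trans (iInf₂_le n h))
  refine ⟨⟨le_iInf₂ fun n hn => Nat.cast_le.mpr (hle n hn), ?_⟩, fun n p hn hp => ?_⟩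
  · obtain ⟨n, hn⟩ := hM
    obtain ⟨p, hp, ⟨e⟩⟩ := id hn
    rw [nthSyzygy_nthSyzygy] at e
    obtain ⟨e'⟩ := (stablyIsomorphic_nthSyzygy hext (hle n hn) e).nonempty_syzygy_equiv
    refine iInf₂_le (r + 1) (⟨p, hp, ?_⟩ : IsPeriodic (nthSyzygy M (r + 1)))
    rw [nthSyzygy_nthSyzygy, Nat.add_right_comm]
    exact ⟨e'⟩
  · have hper : IsPeriodic (nthSyzygy M n) := of_iInf_natCast_eq hn
    obtain ⟨-, ⟨e⟩⟩ : 0 < period (nthSyzygy M n) ∧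
        Nonempty (nthSyzygy (nthSyzygy M n) (period (nthSyzygy M n)) ≃ₗ[R] nthSyzygy M n) :=
      Nat.sInf_mem (s := {p : ℕ | 0 < p ∧
        Nonempty (nthSyzygy (nthSyzygy M n) p ≃ₗ[R] nthSyzygy M n)}) hper
    rw [hp, nthSyzygy_nthSyzygy] at e
    exact (stablyIsomorphic_nthSyzygy hext (hle n hper) e).toStable
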